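/- Let $n\ge 2$, $a>0$, $a\ne 1$, $0<s<a/2$, and put $r=2s/(a-2s)$. Let $(t_m)_{m\ge 1}$ be a sequence of real numbers with $1>t_1>t_2>t_3>\dots>0$ and $\lim_{m\to\infty}t_m=0$ that belongs to weak $l^r$, i.e. there is a constant $C>0$ such that $\#\{m : t_m>b\}\le C\,b^{-r}$ for all $b>0$. For $f\in L^2(\mathbb{R}^n)$ and $t\ge 0$ put $\hat f(\xi)=\int_{\mathbb{R}^n}e^{-i\xi\cdot x}f(x)\,dx$ and $$S_tf(x)=(2\pi)^{-n}\int_{\mathbb{R}^n}e^{i\xi\cdot x}e^{it|\xi|^a}\hat f(\xi)\,d\xi ,$$ where both integrals are understood in the $L^2$ (Plancherel) sense, and let $H_s(\mathbb{R}^n)$ be the space of tempered distributions $f$ whose Fourier transform $\hat f$ is a function with $\int_{\mathbb{R}^n}(1+|\xi|^2)^s|\hat f(\xi)|^2\,d\xi<\infty$; as $s>0$, every such $f$ is a function in $L^2(\mathbb{R}^n)$. Then for every $f\in H_s(\mathbb{R}^n)$, $$\lim_{m\to\infty}S_{t_m}f(x)=f(x)\quad\text{for almost every }x\in\mathbb{R}^n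 .$$ -/

import Mathlib

open MeasureTheory Filter
open scoped Topology FourierTransform SchwartzMap ENNReal

/-- The space `ℝⁿ` with its Euclidean norm and Lebesgue measure. -/
abbrev Rn (n : ℕ) : Type := EuclideanSpace ℝ (Fin n)

/-- The multiplier `exp (i t |ξ|^a)` of the Schrödinger mean, written in the frequency variable
`η = ξ / (2π)` of Mathlib's Fourier transform `𝓕 f η = ∫ exp (-2πi ⟨η, x⟩) f x dx`. -/
noncomputable def schrodingerMultiplier {n : ℕ} (a t : ℝ) (η : Rn n) : ℂ :=
  Complex.exp (Complex.I * ((t * ‖(2 * Real.pi) • η‖ ^ a : ℝ) : ℂ))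

theorem memLp_schrodingerMultiplier {n : ℕ} (a t : ℝ) :
    MemLp (schrodingerMultiplier (n := n) a t) ∞ (volume : Measure (Rn n)) := by
  refine memLp_top_of_bound (C := 1) ?_ (Eventually.of_forall fun η => ?_)
  · have h : Measurable (schrodingerMultiplier (n := n) a t) := by
      unfold schrodingerMultiplier
      fun_prop
    exact h.aestronglyMeasurable
  · rw [schrodingerMultiplier, mul_comm, Complex.norm_exp_ofReal_mul_I]

/-- The Schrödinger mean `S_t f`, for `f ∈ L²(ℝⁿ)` and with the Fourier transform on `L²`.
With `f̂ ξ = ∫ exp (-i ⟨ξ, x⟩) f x dx`, so that `f̂ (2π η) = 𝓕 f η`, the substitution `ξ = 2π η` gives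
`(2π)⁻ⁿ ∫ exp (i ⟨ξ, x⟩) exp (i t |ξ|^a) f̂ ξ dξ`
`  = ∫ exp (2πi ⟨η, x⟩) exp (i t |2π η|^a) 𝓕 f η dη`. -/
noncomputable def schrodingerMean {n : ℕ} (a t : ℝ) (f : Lp ℂ 2 (volume : Measure (Rn n))) :
    Lp ℂ 2 (volume : Measure (Rn n)) :=
  𝓕⁻ (((memLp_schrodingerMultiplier a t).toLp (schrodingerMultiplier (n := n) a t) •
    (𝓕 f : Lp ℂ 2 (volume : Measure (Rn n))) : Lp ℂ 2 (volume : Measure (Rn n))))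

/-- The sequence `t` lies in weak `l^r`: the number of `m` with `t m > b` is finite and at most
`C b^{-r}` for all `b > 0`, with a constant `C` independent of `b`. -/
def MemWeakLr (r : ℝ) (t : ℕ → ℝ) : Prop :=
  ∃ C : ℝ, 0 < C ∧ ∀ b : ℝ, 0 < b →
    {m : ℕ | b < t m}.Finite ∧ ({m : ℕ | b < t m}.ncard : ℝ) ≤ C * b ^ (-r)

/-!
The proof is a direct square function argument on the frequency side, with no density argument. Let
`U` be the inverse Fourier transform, `F` the Fourier transform of `g`, `φ = |ξ| ^ a` and
`θ = (a - 2 s) / a`. Then `φ ^ (1 - θ) = |ξ| ^ (2 s)`, so that `∫ φ ^ (1 - θ) |F|² < ∞`, and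
`r = (1 - θ) / θ`. The claim is `U (exp (i t m φ) F) → U F` almost everywhere, and it only uses that
`U` is an isometry of `L²` (`ae_tendsto_applyL2_exp`).

Let `2 ^ (-l - 1) < t m ≤ 2 ^ (-l)` and `L = 2 ^ l`. The frequencies are split at `φ = L` and at
`φ ^ θ = L`, and each part of `U (exp (i t m φ) F) - U F` is dominated by a function that depends
on `l` only, or is summed over `m` directly.

* Low frequencies, `φ < L`: here `t m φ ≤ 1`, and the Taylor series of `exp (i t m φ) - 1` gives
  a majorant with square integral at most a constant times `∫_{φ < L} (φ / L)² |F|²`.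
* The tail `U (F 1_{L ≤ φ})` of `U F`, with square integral `∫_{L ≤ φ} |F|²`.
* Intermediate frequencies, `L ≤ φ` and `φ ^ θ ≤ L`: on the band `⌊φ / L⌋ = j` the phase `t m φ` is
  within `1` of the constant `t m L j`, so the Taylor series gives a majorant on each band. The
  bands are put together by the Cauchy–Schwarz inequality with the weights `j ^ (1 - θ / 2)`; the
  square integral of the sum is at most a constant times
  `∫_{φ ^ θ ≤ L} φ ^ (1 - θ) (φ ^ θ / L) ^ (1 / 2) |F|²` (`lintegral_bandMajorant_sq_le`).
* High frequencies, `L < φ ^ θ`: Plancherel for each `m`. For a given frequency the number of `m`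
  concerned is at most a constant times `φ ^ (θ r) = φ ^ (1 - θ)`, by the weak `l^r` condition
  (`tsum_ite_lt_rpow_le`).

In each case the sum of the square integrals over `l`, or over `m`, is a geometric series or a
counting function at each frequency, and is at most a constant times `∫ φ ^ (1 - θ) |F|² < ∞`. Hence
the sums of squares are finite almost everywhere and their terms tend to `0`
(`ae_tendsto_zero_of_lintegral_sq_le`).
-/

/-! ### Isometries of `L²` acting on functions -/

section Isometry

variable {X Y : Type*} [MeasurableSpace X] [MeasurableSpace Y] {μ : Measure X} {ν : Measure Y}

open Classical in
/-- The image of a function `u` under an isometry `U` of `L²` spaces, as a function. It is `0` if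
`u` is not in `L²`. -/
noncomputable def applyL2 (U : Lp ℂ 2 μ →ₗᵢ[ℂ] Lp ℂ 2 ν) (u : X → ℂ) : Y → ℂ :=
  if h : MemLp u 2 μ then ⇑(U (h.toLp u)) else 0

theorem applyL2_of_memLp (U : Lp ℂ 2 μ →ₗᵢ[ℂ] Lp ℂ 2 ν) {u : X → ℂ} (h : MemLp u 2 μ) :
    applyL2 U u = ⇑(U (h.toLp u)) := by
  rw [applyL2, dif_pos h]

theorem aestronglyMeasurable_applyL2 (U : Lp ℂ 2 μ →ₗᵢ[ℂ] Lp ℂ 2 ν) (u : X → ℂ) :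
    AEStronglyMeasurable (applyL2 U u) ν := by
  unfold applyL2
  split_ifs
  · exact Lp.aestronglyMeasurable _
  · exact aestronglyMeasurable_const

theorem lintegral_enorm_sq_eq_enorm_sq (g : Lp ℂ 2 μ) :
    ∫⁻ x, ‖g x‖ₑ ^ 2 ∂μ = ‖g‖ₑ ^ 2 := by
  rw [Lp.enorm_def, eLpNorm_eq_lintegral_rpow_enorm_toReal (by norm_num) (by norm_num)]
  simp only [ENNReal.toReal_ofNat, one_div]
  rw [← ENNReal.rpow_natCast, ← ENNReal.rpow_mul]
  simp

theorem lintegral_enorm_sq_applyL2 (U : Lp ℂ 2 μ →ₗᵢ[ℂ] Lp ℂ 2 ν) {u : X → ℂ}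
    (h : MemLp u 2 μ) :
    ∫⁻ y, ‖applyL2 U u y‖ₑ ^ 2 ∂ν = ∫⁻ x, ‖u x‖ₑ ^ 2 ∂μ := by
  rw [applyL2_of_memLp U h, lintegral_enorm_sq_eq_enorm_sq]
  have : ‖U (h.toLp u)‖ₑ = ‖h.toLp u‖ₑ := by
    rw [← ofReal_norm, ← ofReal_norm, U.norm_map]
  rw [this, ← lintegral_enorm_sq_eq_enorm_sq]
  refine lintegral_congr_ae ?_
  filter_upwards [h.coeFn_toLp] with x hx
  rw [hx]

theorem applyL2_const_mul (U : Lp ℂ 2 μ →ₗᵢ[ℂ] Lp ℂ 2 ν) {u : X → ℂ} (h : MemLp u 2 μ)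
    (c : ℂ) : applyL2 U (fun x => c * u x) =ᵐ[ν] fun y => c * applyL2 U u y := by
  have h' : MemLp (fun x => c * u x) 2 μ := h.const_mul c
  have e : h'.toLp _ = c • h.toLp u := (MemLp.toLp_const_smul c h)
  rw [applyL2_of_memLp U h', applyL2_of_memLp U h, e, map_smul]
  filter_upwards [Lp.coeFn_smul c (U (h.toLp u))] with y hy
  rw [hy]; rfl

/-- Countable subadditivity of `u ↦ ‖U u‖` almost everywhere. -/
theorem enorm_applyL2_le_tsum {ι : Type*} [Countable ι] (U : Lp ℂ 2 μ →ₗᵢ[ℂ] Lp ℂ 2 ν)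
    {u : X → ℂ} {v : ι → X → ℂ} (hu : MemLp u 2 μ) (hv : ∀ i, MemLp (v i) 2 μ)
    (hsum : ∀ x, HasSum (fun i => v i x) (u x)) (hfin : ∑' i, eLpNorm (v i) 2 μ ≠ ∞) :
    ∀ᵐ y ∂ν, ‖applyL2 U u y‖ₑ ≤ ∑' i, ‖applyL2 U (v i) y‖ₑ := by
  set g : ι → Lp ℂ 2 μ := fun i => (hv i).toLp (v i) with hg
  have hgfin : ∑' i, ‖g i‖ₑ ≠ ∞ := by
    simpa only [hg, Lp.enorm_toLp] using hfin
  have e1 : hu.toLp u = ∑' i, g i := by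
    refine Lp.ext ?_
    have hall : ∀ᵐ x ∂μ, ∀ i, g i x = v i x := ae_all_iff.2 fun i => (hv i).coeFn_toLp
    filter_upwards [hu.coeFn_toLp, Lp.hasSum_coeFn_tsum hgfin, hall] with x h1 h2 h3
    rw [h1]
    simp only [h3] at h2
    exact (hsum x).unique h2
  have hgs : Summable g := Summable.of_enorm hgfin
  have e2 : U (hu.toLp u) = ∑' i, U (g i) := by
    rw [e1]
    exact U.toContinuousLinearMap.map_tsum hgs
  have hUfin : ∑' i, ‖U (g i)‖ₑ ≠ ∞ := by
    have : ∀ i, ‖U (g i)‖ₑ = ‖g i‖ₑ := fun i => by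
      rw [← ofReal_norm, ← ofReal_norm, U.norm_map]
    simpa only [this] using hgfin
  rw [applyL2_of_memLp U hu, e2]
  filter_upwards [Lp.coeFn_tsum hUfin] with y hy
  rw [hy]
  refine (enorm_tsum_le_tsum_enorm).trans (le_of_eq ?_)
  refine tsum_congr fun i => ?_
  rw [applyL2_of_memLp U (hv i)]

/-- Finite subadditivity of `u ↦ ‖U u‖` almost everywhere. -/
theorem enorm_applyL2_le_sum {ι : Type*} (s : Finset ι) (U : Lp ℂ 2 μ →ₗᵢ[ℂ] Lp ℂ 2 ν)
    {u : X → ℂ} {v : ι → X → ℂ} (hv : ∀ i, MemLp (v i) 2 μ) (hsum : ∀ x, ∑ i ∈ s, v i x = u x) :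
    ∀ᵐ y ∂ν, ‖applyL2 U u y‖ₑ ≤ ∑ i ∈ s, ‖applyL2 U (v i) y‖ₑ := by
  have hu : MemLp u 2 μ :=
    (memLp_finsetSum s fun i _ => hv i).ae_eq (Eventually.of_forall hsum)
  have := enorm_applyL2_le_tsum (ι := s) U (v := fun i => v i) hu (fun i => hv i)
    (fun x => by
      have h := hasSum_fintype fun i : s => v i x
      rwa [Finset.sum_coe_sort s (fun i => v i x), hsum x] at h)
    (by
      rw [tsum_fintype]
      exact (ENNReal.sum_lt_top.2 fun (i : s) _ => (hv i).eLpNorm_lt_top).ne)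
  filter_upwards [this] with y hy
  rwa [tsum_fintype, Finset.sum_coe_sort s (fun i => ‖applyL2 U (v i) y‖ₑ)] at hy

theorem applyL2_add (U : Lp ℂ 2 μ →ₗᵢ[ℂ] Lp ℂ 2 ν) {u v : X → ℂ} (hu : MemLp u 2 μ)
    (hv : MemLp v 2 μ) :
    applyL2 U (fun x => u x + v x) =ᵐ[ν] fun y => applyL2 U u y + applyL2 U v y := by
  have h' : MemLp (fun x => u x + v x) 2 μ := hu.add hv
  have e : h'.toLp _ = hu.toLp u + hv.toLp v := MemLp.toLp_add hu hv
  rw [applyL2_of_memLp U h', applyL2_of_memLp U hu, applyL2_of_memLp U hv, e, map_add]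
  exact Lp.coeFn_add _ _

/-- Weighted Cauchy–Schwarz inequality for series in `[0, ∞]`. -/
theorem ENNReal.tsum_mul_sq_le {ι : Type*} (b c : ι → ℝ≥0∞) :
    (∑' i, b i * c i) ^ 2 ≤ (∑' i, b i) * ∑' i, b i * c i ^ 2 := by
  let _ : MeasurableSpace ι := ⊤
  have key := ENNReal.lintegral_mul_le_Lp_mul_Lq (Measure.count (α := ι))
    Real.HolderConjugate.two_two
    (f := fun i => b i ^ (1 / 2 : ℝ)) (g := fun i => b i ^ (1 / 2 : ℝ) * c i)
    measurable_from_top.aemeasurable measurable_from_top.aemeasurable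
  simp only [lintegral_count, Pi.mul_apply] at key
  have h1 : ∀ i, b i ^ (1 / 2 : ℝ) * (b i ^ (1 / 2 : ℝ) * c i) = b i * c i := fun i => by
    rw [← mul_assoc, ← ENNReal.rpow_add_of_nonneg _ _ (by norm_num) (by norm_num)]
    norm_num
  have h2 : ∀ i, (b i ^ (1 / 2 : ℝ)) ^ (2 : ℝ) = b i := fun i => by
    rw [← ENNReal.rpow_mul]; norm_num
  have h3 : ∀ i, (b i ^ (1 / 2 : ℝ) * c i) ^ (2 : ℝ) = b i * c i ^ 2 := fun i => by
    rw [ENNReal.mul_rpow_of_nonneg _ _ (by norm_num), h2, ENNReal.rpow_two]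
  simp only [h1, h2, h3] at key
  calc (∑' i, b i * c i) ^ 2
      ≤ ((∑' i, b i) ^ (1 / 2 : ℝ) * (∑' i, b i * c i ^ 2) ^ (1 / 2 : ℝ)) ^ 2 := by gcongr
    _ = _ := by
      rw [mul_pow, ← ENNReal.rpow_two, ← ENNReal.rpow_two, ← ENNReal.rpow_mul,
        ← ENNReal.rpow_mul]
      norm_num

theorem ENNReal.sum_mul_sq_le {ι : Type*} (s : Finset ι) (b c : ι → ℝ≥0∞) :
    (∑ i ∈ s, b i * c i) ^ 2 ≤ (∑ i ∈ s, b i) * ∑ i ∈ s, b i * c i ^ 2 := by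
  have h := ENNReal.tsum_mul_sq_le (fun i : s => b i) (fun i : s => c i)
  rwa [tsum_fintype, tsum_fintype, tsum_fintype, Finset.sum_coe_sort s (fun i => b i * c i),
    Finset.sum_coe_sort s b, Finset.sum_coe_sort s (fun i => b i * c i ^ 2)] at h

end Isometry

/-! ### Taylor majorants -/

section Taylor

variable {X Y : Type*} [MeasurableSpace X] [MeasurableSpace Y] {μ : Measure X} {ν : Measure Y}

/-- The constant `e = ∑ 1 / p!` in `[0, ∞]`. -/
noncomputable def expOne : ℝ≥0∞ := ∑' p : ℕ, ENNReal.ofReal (p.factorial : ℝ)⁻¹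

theorem summable_inv_factorial : Summable fun p : ℕ => ((p.factorial : ℝ)⁻¹) := by
  simpa using Real.summable_pow_div_factorial 1

theorem expOne_ne_top : expOne ≠ ∞ :=
  summable_inv_factorial.tsum_ofReal_ne_top

/-- The function `∑ₚ |U (ψᵖ v)| / p!`, which dominates `U (m v)` simultaneously for all functions
`m = ∑ₚ cₚ ψᵖ` with `|cₚ| ≤ 1 / p!`. -/
noncomputable def taylorMajorant (U : Lp ℂ 2 μ →ₗᵢ[ℂ] Lp ℂ 2 ν) (ψ : X → ℝ) (v : X → ℂ) (y : Y) :
    ℝ≥0∞ :=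
  ∑' p : ℕ, ENNReal.ofReal (p.factorial : ℝ)⁻¹ *
    ‖applyL2 U (fun x => ((ψ x : ℂ)) ^ p * v x) y‖ₑ

omit [MeasurableSpace X] in
theorem norm_pow_mul_le {ψ : X → ℝ} {v : X → ℂ} (hψ1 : ∀ x, v x ≠ 0 → |ψ x| ≤ 1) (p : ℕ) (x : X) :
    ‖(ψ x : ℂ) ^ p * v x‖ ≤ ‖v x‖ := by
  by_cases h : v x = 0
  · simp [h]
  · rw [norm_mul, norm_pow, Complex.norm_real, Real.norm_eq_abs]
    exact mul_le_of_le_one_left (norm_nonneg _) (pow_le_one₀ (abs_nonneg _) (hψ1 x h))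

theorem memLp_pow_mul {ψ : X → ℝ} {v : X → ℂ} (hψ : Measurable ψ) (hv : MemLp v 2 μ)
    (hψ1 : ∀ x, v x ≠ 0 → |ψ x| ≤ 1) (p : ℕ) : MemLp (fun x => (ψ x : ℂ) ^ p * v x) 2 μ :=
  hv.of_le (((Complex.measurable_ofReal.comp hψ).pow_const p).aestronglyMeasurable.mul hv.1)
    (Eventually.of_forall (norm_pow_mul_le hψ1 p))

theorem aemeasurable_taylorMajorant (U : Lp ℂ 2 μ →ₗᵢ[ℂ] Lp ℂ 2 ν) (ψ : X → ℝ) (v : X → ℂ) :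
    AEMeasurable (taylorMajorant U ψ v) ν :=
  AEMeasurable.tsum fun _ => (aestronglyMeasurable_applyL2 U _).enorm.const_mul _

theorem lintegral_taylorMajorant_sq_le (U : Lp ℂ 2 μ →ₗᵢ[ℂ] Lp ℂ 2 ν) {ψ : X → ℝ} {v : X → ℂ}
    (hψ : Measurable ψ) (hv : MemLp v 2 μ) (hψ1 : ∀ x, v x ≠ 0 → |ψ x| ≤ 1) :
    ∫⁻ y, taylorMajorant U ψ v y ^ 2 ∂ν ≤ expOne ^ 2 * ∫⁻ x, ‖v x‖ₑ ^ 2 ∂μ := by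
  calc ∫⁻ y, taylorMajorant U ψ v y ^ 2 ∂ν
      ≤ ∫⁻ y, expOne * ∑' p : ℕ, ENNReal.ofReal (p.factorial : ℝ)⁻¹ *
          ‖applyL2 U (fun x => (ψ x : ℂ) ^ p * v x) y‖ₑ ^ 2 ∂ν :=
        lintegral_mono fun y => ENNReal.tsum_mul_sq_le _ _
    _ = expOne * ∑' p : ℕ, ENNReal.ofReal (p.factorial : ℝ)⁻¹ *
          ∫⁻ x, ‖(ψ x : ℂ) ^ p * v x‖ₑ ^ 2 ∂μ := by
        rw [lintegral_const_mul' _ _ expOne_ne_top, lintegral_tsum fun p =>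
          ((aestronglyMeasurable_applyL2 U _).enorm.pow_const 2).const_mul _]
        congr 1
        refine tsum_congr fun p => ?_
        rw [lintegral_const_mul' _ _ ENNReal.ofReal_ne_top,
          lintegral_enorm_sq_applyL2 U (memLp_pow_mul hψ hv hψ1 p)]
    _ ≤ expOne * ∑' p : ℕ, ENNReal.ofReal (p.factorial : ℝ)⁻¹ * ∫⁻ x, ‖v x‖ₑ ^ 2 ∂μ := by
        gcongr with p x
        exact enorm_le_iff_norm_le.2 (norm_pow_mul_le hψ1 p x)
    _ = _ := by rw [ENNReal.tsum_mul_right, ← mul_assoc, sq]; rfl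

/-- The majorant does not depend on the coefficients `c`, so it dominates a supremum over times. -/
theorem enorm_applyL2_le_taylorMajorant (U : Lp ℂ 2 μ →ₗᵢ[ℂ] Lp ℂ 2 ν) {ψ : X → ℝ} {u v : X → ℂ}
    (hψ : Measurable ψ) (hv : MemLp v 2 μ) (hψ1 : ∀ x, v x ≠ 0 → |ψ x| ≤ 1) (hu : MemLp u 2 μ)
    {c : ℕ → ℂ} (hc : ∀ p, ‖c p‖ ≤ (p.factorial : ℝ)⁻¹)
    (hsum : ∀ x, HasSum (fun p => c p * ((ψ x : ℂ) ^ p * v x)) (u x)) :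
    ∀ᵐ y ∂ν, ‖applyL2 U u y‖ₑ ≤ taylorMajorant U ψ v y := by
  have hm := memLp_pow_mul hψ hv hψ1
  have hce : ∀ p, ‖c p‖ₑ ≤ ENNReal.ofReal (p.factorial : ℝ)⁻¹ := fun p => by
    rw [← ofReal_norm]; exact ENNReal.ofReal_le_ofReal (hc p)
  have hfin : ∑' p, eLpNorm (fun x => c p * ((ψ x : ℂ) ^ p * v x)) 2 μ ≠ ∞ := by
    have : ∑' p, eLpNorm (fun x => c p * ((ψ x : ℂ) ^ p * v x)) 2 μ ≤ expOne * eLpNorm v 2 μ := by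
      rw [expOne, ← ENNReal.tsum_mul_right]
      refine ENNReal.tsum_le_tsum fun p => ?_
      have e : (fun x => c p * ((ψ x : ℂ) ^ p * v x)) = c p • fun x => (ψ x : ℂ) ^ p * v x := rfl
      rw [e, eLpNorm_const_smul]
      gcongr
      · exact hce p
      · exact eLpNorm_mono (norm_pow_mul_le hψ1 p)
    exact ne_top_of_le_ne_top (ENNReal.mul_ne_top expOne_ne_top hv.eLpNorm_ne_top) this
  have hall : ∀ᵐ y ∂ν, ∀ p, applyL2 U (fun x => c p * ((ψ x : ℂ) ^ p * v x)) y =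
      c p * applyL2 U (fun x => (ψ x : ℂ) ^ p * v x) y :=
    ae_all_iff.2 fun p => applyL2_const_mul U (hm p) (c p)
  filter_upwards [enorm_applyL2_le_tsum U hu (fun p => (hm p).const_mul (c p)) hsum hfin, hall]
    with y h1 h2
  refine h1.trans (ENNReal.tsum_le_tsum fun p => ?_)
  rw [h2 p, enorm_mul]
  gcongr
  exact hce p

theorem norm_I_mul_pow_div_factorial_le {τ : ℝ} (h0 : 0 ≤ τ) (h1 : τ ≤ 1) (p : ℕ) :
    ‖(Complex.I * τ) ^ p / (p.factorial : ℂ)‖ ≤ (p.factorial : ℝ)⁻¹ := by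
  rw [norm_div, norm_pow, norm_mul, Complex.norm_I, one_mul, Complex.norm_real, Real.norm_eq_abs,
    abs_of_nonneg h0, Complex.norm_natCast, div_eq_mul_inv]
  exact mul_le_of_le_one_left (by positivity) (pow_le_one₀ h0 h1)

theorem hasSum_exp_I_mul (τ s : ℝ) :
    HasSum (fun p : ℕ => (Complex.I * τ) ^ p / (p.factorial : ℂ) * (s : ℂ) ^ p)
      (Complex.exp (Complex.I * ((τ * s : ℝ) : ℂ))) := by
  have h := NormedSpace.expSeries_div_hasSum_exp (𝔸 := ℂ) (Complex.I * ((τ * s : ℝ) : ℂ))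
  rw [← Complex.exp_eq_exp_ℂ] at h
  refine h.congr_fun fun p => ?_
  rw [Complex.ofReal_mul, ← mul_assoc, mul_pow _ (s : ℂ), div_mul_eq_mul_div]

theorem norm_exp_I_mul (s : ℝ) : ‖Complex.exp (Complex.I * (s : ℂ))‖ = 1 := by
  rw [mul_comm, Complex.norm_exp_ofReal_mul_I]

theorem memLp_exp_I_mul {φ : X → ℝ} {v : X → ℂ} (hφ : Measurable φ) (hv : MemLp v 2 μ) :
    MemLp (fun x => Complex.exp (Complex.I * (φ x : ℂ)) * v x) 2 μ :=
  hv.of_le ((by fun_prop : Measurable fun x =>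
      Complex.exp (Complex.I * (φ x : ℂ))).aestronglyMeasurable.mul hv.1)
    (Eventually.of_forall fun x => by rw [norm_mul, norm_exp_I_mul, one_mul])

/-- All the functions `U (exp (i τ ψ) v)` with `0 ≤ τ ≤ 1` have a common majorant, with square
integral controlled by that of `v`, if `|ψ| ≤ 1` where `v ≠ 0`. A constant `κ` may be added to the
phase, as it only contributes the unimodular factor `exp (i κ)`. -/
theorem enorm_applyL2_exp_le (U : Lp ℂ 2 μ →ₗᵢ[ℂ] Lp ℂ 2 ν) {ψ φ : X → ℝ} {v : X → ℂ}
    (hψ : Measurable ψ) (hv : MemLp v 2 μ) (hψ1 : ∀ x, v x ≠ 0 → |ψ x| ≤ 1) {τ κ : ℝ}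
    (h0 : 0 ≤ τ) (h1 : τ ≤ 1) (hφ : ∀ x, φ x = κ + τ * ψ x) :
    ∀ᵐ y ∂ν, ‖applyL2 U (fun x => Complex.exp (Complex.I * (φ x : ℂ)) * v x) y‖ₑ ≤
      taylorMajorant U ψ v y := by
  have hm : MemLp (fun x => Complex.exp (Complex.I * ((τ * ψ x : ℝ) : ℂ)) * v x) 2 μ :=
    memLp_exp_I_mul (hψ.const_mul τ) hv
  have e : (fun x => Complex.exp (Complex.I * (φ x : ℂ)) * v x) = fun x =>
      Complex.exp (Complex.I * (κ : ℂ)) * (Complex.exp (Complex.I * ((τ * ψ x : ℝ) : ℂ)) * v x) := by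
    funext x
    rw [hφ, ← mul_assoc, ← Complex.exp_add, Complex.ofReal_add, mul_add]
  rw [e]
  filter_upwards [applyL2_const_mul U hm (Complex.exp (Complex.I * (κ : ℂ))),
    enorm_applyL2_le_taylorMajorant U hψ hv hψ1 hm (norm_I_mul_pow_div_factorial_le h0 h1)
      (fun x => by simpa only [mul_assoc] using (hasSum_exp_I_mul τ (ψ x)).mul_right (v x))]
    with y h2 h3
  rw [h2, enorm_mul, ← ofReal_norm (Complex.exp _), norm_exp_I_mul, ENNReal.ofReal_one, one_mul]
  exact h3

/-- For the differences `U (exp (i τ ψ) v) - U v` with `0 ≤ τ ≤ 1` the majorant gains a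
factor `ψ`, since the Taylor series has no constant term. -/
theorem enorm_applyL2_exp_sub_one_le (U : Lp ℂ 2 μ →ₗᵢ[ℂ] Lp ℂ 2 ν) {ψ φ : X → ℝ} {v : X → ℂ}
    (hψ : Measurable ψ) (hv : MemLp v 2 μ) (hψ1 : ∀ x, v x ≠ 0 → |ψ x| ≤ 1) {τ : ℝ}
    (h0 : 0 ≤ τ) (h1 : τ ≤ 1) (hφ : ∀ x, φ x = τ * ψ x) :
    ∀ᵐ y ∂ν, ‖applyL2 U (fun x => (Complex.exp (Complex.I * (φ x : ℂ)) - 1) * v x) y‖ₑ ≤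
      taylorMajorant U ψ (fun x => (ψ x : ℂ) * v x) y := by
  have hv' : MemLp (fun x => (ψ x : ℂ) * v x) 2 μ := by
    simpa using memLp_pow_mul hψ hv hψ1 1
  refine enorm_applyL2_le_taylorMajorant U hψ hv' (fun x hx => hψ1 x (right_ne_zero_of_mul hx))
    ?_ (c := fun p => (Complex.I * τ) ^ (p + 1) / ((p + 1).factorial : ℂ)) (fun p => ?_)
    (fun x => ?_)
  · have := (memLp_exp_I_mul (μ := μ) (hψ.const_mul τ) hv).sub hv
    refine this.ae_eq (Eventually.of_forall fun x => ?_)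
    simp only [Pi.sub_apply, hφ]
    ring
  · refine (norm_I_mul_pow_div_factorial_le h0 h1 (p + 1)).trans ?_
    have : (p.factorial : ℝ) ≤ ((p + 1).factorial : ℝ) := by
      exact_mod_cast Nat.factorial_le (Nat.le_succ p)
    gcongr
  · have h := (hasSum_nat_add_iff' 1).2 (hasSum_exp_I_mul τ (ψ x))
    have h' := h.mul_right (v x)
    rw [hφ]
    simp only [Finset.range_one, Finset.sum_singleton, pow_zero, Nat.factorial_zero, Nat.cast_one,
      div_one, mul_one] at h'
    refine h'.congr_fun fun p => ?_
    ring

end Taylor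

/-! ### Numerical series -/

section Sums

/-- The geometric series `∑ₗ (2ˡ)⁻ᵉ` in `[0, ∞]`. -/
noncomputable def geomTwo (e : ℝ) : ℝ≥0∞ := ∑' l : ℕ, ENNReal.ofReal (((2 : ℝ) ^ l) ^ (-e))

theorem geomTwo_ne_top {e : ℝ} (he : 0 < e) : geomTwo e ≠ ∞ := by
  have h : ∀ l : ℕ, ((2 : ℝ) ^ l) ^ (-e) = ((2 : ℝ) ^ (-e)) ^ l := fun l => by
    rw [← Real.rpow_natCast, ← Real.rpow_mul (by norm_num), ← Real.rpow_natCast,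
      ← Real.rpow_mul (by norm_num), mul_comm]
  have hs : Summable fun l : ℕ => ((2 : ℝ) ^ l) ^ (-e) := by
    simp only [h]
    exact summable_geometric_of_lt_one (by positivity)
      (Real.rpow_lt_one_of_one_lt_of_neg (by norm_num) (by linarith))
  exact hs.tsum_ofReal_ne_top

theorem tsum_ofReal_div_two_pow_rpow {A e : ℝ} (hA : 0 ≤ A) :
    ∑' l : ℕ, ENNReal.ofReal ((A / 2 ^ l) ^ e) = geomTwo e * ENNReal.ofReal (A ^ e) := by
  rw [geomTwo, ← ENNReal.tsum_mul_right]
  refine tsum_congr fun l => ?_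
  rw [← ENNReal.ofReal_mul (by positivity), Real.div_rpow hA (by positivity),
    Real.rpow_neg (by positivity), div_eq_mul_inv, mul_comm]

/-- The first index `l₀` with `A ≤ 2 ^ l₀` gives a term at most `1`, and the terms after it decay
geometrically, so the bound does not depend on `A`. -/
theorem tsum_ite_ofReal_div_two_pow_rpow_le {A e : ℝ} (hA : 0 ≤ A) (he : 0 ≤ e) :
    ∑' l : ℕ, (if A ≤ 2 ^ l then ENNReal.ofReal ((A / 2 ^ l) ^ e) else 0) ≤ geomTwo e := by
  classical
  have hex : ∃ l : ℕ, A ≤ 2 ^ l := by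
    obtain ⟨l, hl⟩ := pow_unbounded_of_one_lt A (one_lt_two)
    exact ⟨l, hl.le⟩
  set l₀ := Nat.find hex with hl₀
  have hspec : A ≤ 2 ^ l₀ := Nat.find_spec hex
  have hsupp : Function.support (fun l : ℕ =>
      (if A ≤ 2 ^ l then ENNReal.ofReal ((A / 2 ^ l) ^ e) else 0)) ⊆ Set.range (· + l₀) := by
    intro l hl
    have : A ≤ 2 ^ l := by
      by_contra h
      simp [h] at hl
    have h2 : l₀ ≤ l := Nat.find_min' hex this
    exact ⟨l - l₀, Nat.sub_add_cancel h2⟩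
  rw [← (add_left_injective l₀).tsum_eq hsupp, geomTwo]
  refine ENNReal.tsum_le_tsum fun k => ?_
  split_ifs
  · refine ENNReal.ofReal_le_ofReal ?_
    rw [Real.rpow_neg (by positivity), ← Real.inv_rpow (by positivity)]
    refine Real.rpow_le_rpow (by positivity) ?_ he
    rw [pow_add, div_le_iff₀ (by positivity), inv_mul_cancel_left₀ (by positivity)]
    exact hspec
  · exact zero_le

/-- Comparison of `j ^ (p - 1)` with the increment of `j ^ p / p`, by Bernoulli's inequality. -/
theorem sum_Icc_rpow_neg_le {p : ℝ} (hp : 0 < p) (hp1 : p ≤ 1) (N : ℕ) :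
    ∑ j ∈ Finset.Icc 1 N, (j : ℝ) ^ (p - 1) ≤ (N : ℝ) ^ p / p := by
  induction N with
  | zero => simp [Real.zero_rpow hp.ne']
  | succ N ih =>
    rw [Finset.sum_Icc_succ_top (by omega)]
    refine (add_le_add_left ih _).trans ?_
    set J : ℝ := ((N + 1 : ℕ) : ℝ) with hJ
    have hJ0 : 0 < J := by positivity
    have hN : (N : ℝ) = J * (1 + -J⁻¹) := by
      rw [mul_add, mul_neg, mul_inv_cancel₀ hJ0.ne', hJ]; push_cast; ring
    have hJ1 : J⁻¹ ≤ 1 := inv_le_one_of_one_le₀ (by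
      rw [hJ]; push_cast; linarith [N.cast_nonneg (α := ℝ)])
    have hb := rpow_one_add_le_one_add_mul_self (s := -J⁻¹) (by linarith) hp.le hp1
    have h2 : (N : ℝ) ^ p ≤ J ^ p * (1 + p * -J⁻¹) := by
      rw [hN, Real.mul_rpow hJ0.le (by linarith)]
      gcongr
    have h3 : J ^ (p - 1) = J ^ p * J⁻¹ := by
      rw [Real.rpow_sub_one hJ0.ne', div_eq_mul_inv]
    rw [h3, div_add' _ _ _ hp.ne']
    gcongr
    nlinarith

end Sums

/-! ### Square functions and intermediate frequencies -/

section Majorants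

variable {X Y : Type*} [MeasurableSpace X] [MeasurableSpace Y] {μ : Measure X} {ν : Measure Y}

/-- Functions whose square integrals have finite sum tend to `0` almost everywhere. The square
integrals are controlled by weights on the frequency side. -/
theorem ae_tendsto_zero_of_lintegral_sq_le {D : ℕ → Y → ℝ≥0∞} {w : ℕ → X → ℝ≥0∞}
    {W G : X → ℝ≥0∞} {K : ℝ≥0∞} (hD : ∀ l, AEMeasurable (D l) ν) (hw : ∀ l, Measurable (w l))
    (hG : AEMeasurable G μ) (hK : K ≠ ∞)
    (hDw : ∀ l, ∫⁻ y, D l y ^ 2 ∂ν ≤ K * ∫⁻ x, w l x * G x ∂μ)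
    (hwW : ∀ x, ∑' l, w l x ≤ W x) (hW : ∫⁻ x, W x * G x ∂μ ≠ ∞) :
    ∀ᵐ y ∂ν, Tendsto (fun l => D l y) atTop (𝓝 0) := by
  have hfin : ∫⁻ y, ∑' l, D l y ^ 2 ∂ν ≠ ∞ := by
    refine ne_top_of_le_ne_top (ENNReal.mul_ne_top hK hW) ?_
    rw [lintegral_tsum fun l => (hD l).pow_const 2]
    calc ∑' l, ∫⁻ y, D l y ^ 2 ∂ν ≤ ∑' l, K * ∫⁻ x, w l x * G x ∂μ := ENNReal.tsum_le_tsum hDw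
      _ = K * ∫⁻ x, (∑' l, w l x) * G x ∂μ := by
        have h := lintegral_tsum fun l => (hw l).aemeasurable.mul hG
        simp only [Pi.mul_apply, ENNReal.tsum_mul_right] at h
        rw [ENNReal.tsum_mul_left, h]
      _ ≤ _ := by
        gcongr with x
        exact hwW x
  filter_upwards [ae_lt_top' (AEMeasurable.tsum fun l => (hD l).pow_const 2) hfin] with y hy
  have h := ENNReal.tendsto_atTop_zero_of_tsum_ne_top hy.ne
  have h2 := (ENNReal.continuous_rpow_const (y := (1 / 2 : ℝ))).tendsto 0 |>.comp h
  have e : ∀ l, (D l y ^ 2) ^ (1 / 2 : ℝ) = D l y := fun l => by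
    rw [← ENNReal.rpow_two, ← ENNReal.rpow_mul]; norm_num
  simpa only [Function.comp_def, e, ENNReal.zero_rpow_of_pos (one_half_pos (α := ℝ))] using h2

/-- The part of `F` at the frequencies with `⌊φ / L⌋ = j` and `φ ^ θ ≤ L`. -/
noncomputable def bandPart (φ : X → ℝ) (θ L : ℝ) (F : X → ℂ) (j : ℕ) : X → ℂ :=
  {x | ⌊φ x / L⌋₊ = j ∧ φ x ^ θ ≤ L}.indicator F

/-- The sum over the bands `1 ≤ j ≤ L ^ (1 / θ - 1)` of their Taylor majorants. -/
noncomputable def bandMajorant (U : Lp ℂ 2 μ →ₗᵢ[ℂ] Lp ℂ 2 ν) (φ : X → ℝ) (θ L : ℝ)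
    (F : X → ℂ) (y : Y) : ℝ≥0∞ :=
  ∑ j ∈ Finset.Icc 1 ⌊L ^ (1 / θ - 1)⌋₊,
    taylorMajorant U (fun x => φ x / L - j) (bandPart φ θ L F j) y

theorem memLp_bandPart {φ : X → ℝ} (hφ : Measurable φ) (θ L : ℝ) {F : X → ℂ} (hF : MemLp F 2 μ)
    (j : ℕ) : MemLp (bandPart φ θ L F j) 2 μ := by
  refine hF.indicator ?_
  exact (measurableSet_eq_fun (Nat.measurable_floor.comp (hφ.div_const L)) measurable_const).inter
    (measurableSet_le (hφ.pow_const θ) measurable_const)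

omit [MeasurableSpace X] in
theorem abs_div_sub_le_of_bandPart_ne_zero {φ : X → ℝ} (hφ0 : ∀ x, 0 ≤ φ x) {θ L : ℝ} (hL : 0 < L)
    {F : X → ℂ} {j : ℕ} (x : X) (hx : bandPart φ θ L F j x ≠ 0) : |φ x / L - j| ≤ 1 := by
  have hj : ⌊φ x / L⌋₊ = j := (Set.mem_of_indicator_ne_zero hx).1
  have h0 : 0 ≤ φ x / L := div_nonneg (hφ0 x) hL.le
  have h1 := Nat.floor_le h0
  have h2 := Nat.lt_floor_add_one (φ x / L)
  rw [hj] at h1 h2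
  rw [abs_le]
  constructor <;> linarith

theorem rpow_half_mul_div_rpow {φ θ L : ℝ} (hφ : 0 ≤ φ) (hθ : 0 < θ) (hθ1 : θ < 1) (hL : 0 < L) :
    L ^ ((1 - θ) / 2) * (φ / L) ^ (1 - θ / 2) = φ ^ (1 - θ) * (φ ^ θ / L) ^ (1 / 2 : ℝ) := by
  rw [Real.div_rpow hφ hL.le, Real.div_rpow (by positivity) hL.le, ← Real.rpow_mul hφ]
  have h1 : φ ^ (1 - θ / 2) = φ ^ (1 - θ) * φ ^ (θ * (1 / 2)) := by
    rw [← Real.rpow_add_of_nonneg hφ (by linarith) (by linarith)]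
    ring_nf
  have h2 : L ^ (1 - θ / 2) = L ^ ((1 - θ) / 2) * L ^ (1 / 2 : ℝ) := by
    rw [← Real.rpow_add hL]
    ring_nf
  rw [h1, h2]
  have : L ^ ((1 - θ) / 2) ≠ 0 := (Real.rpow_pos_of_pos hL _).ne'
  have : L ^ (1 / 2 : ℝ) ≠ 0 := (Real.rpow_pos_of_pos hL _).ne'
  field_simp

/-- Square integral of the band majorant. Summed over `L = 2 ^ l`, the factor
`(φ ^ θ / L) ^ (1 / 2)`, restricted to `φ ^ θ ≤ L`, is at most a convergent geometric series, so that
the weight `φ ^ (1 - θ)` remains. -/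
theorem lintegral_bandMajorant_sq_le (U : Lp ℂ 2 μ →ₗᵢ[ℂ] Lp ℂ 2 ν) {φ : X → ℝ}
    (hφ : Measurable φ) (hφ0 : ∀ x, 0 ≤ φ x) {θ L : ℝ} (hθ : 0 < θ) (hθ1 : θ < 1) (hL : 0 < L)
    {F : X → ℂ} (hF : MemLp F 2 μ) :
    ∫⁻ y, bandMajorant U φ θ L F y ^ 2 ∂ν ≤ (expOne ^ 2 * ENNReal.ofReal (2 / θ)) *
      ∫⁻ x, (ENNReal.ofReal (φ x ^ (1 - θ)) *
        (if φ x ^ θ ≤ L then ENNReal.ofReal ((φ x ^ θ / L) ^ (1 / 2 : ℝ)) else 0)) *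
          ‖F x‖ₑ ^ 2 ∂μ := by
  classical
  set N := ⌊L ^ (1 / θ - 1)⌋₊ with hN
  -- The weight exponent `α = 1 - θ / 2 < 1` keeps the loss in Cauchy–Schwarz at `N ^ (θ / 2)`.
  set α : ℝ := 1 - θ / 2 with hα
  set D : ℕ → Y → ℝ≥0∞ := fun j => taylorMajorant U (fun x => φ x / L - j) (bandPart φ θ L F j)
    with hD
  have hDm : ∀ j, AEMeasurable (D j) ν := fun j => aemeasurable_taylorMajorant U _ _
  have hDint : ∀ j, ∫⁻ y, D j y ^ 2 ∂ν ≤ expOne ^ 2 * ∫⁻ x, ‖bandPart φ θ L F j x‖ₑ ^ 2 ∂μ :=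
    fun j => lintegral_taylorMajorant_sq_le U ((hφ.div_const L).sub_const _)
      (memLp_bandPart hφ θ L hF j) (abs_div_sub_le_of_bandPart_ne_zero hφ0 hL)
  have hB : ∑ j ∈ Finset.Icc 1 N, ENNReal.ofReal ((j : ℝ) ^ (-α)) ≤
      ENNReal.ofReal (2 / θ) * ENNReal.ofReal (L ^ ((1 - θ) / 2)) := by
    rw [← ENNReal.ofReal_sum_of_nonneg fun j _ => by positivity, ← ENNReal.ofReal_mul (by positivity)]
    refine ENNReal.ofReal_le_ofReal ?_
    have h := sum_Icc_rpow_neg_le (p := θ / 2) (by linarith) (by linarith) N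
    have e : θ / 2 - 1 = -α := by rw [hα]; ring
    rw [e] at h
    refine h.trans ?_
    have h1 : (N : ℝ) ^ (θ / 2) ≤ (L ^ (1 / θ - 1)) ^ (θ / 2) :=
      Real.rpow_le_rpow (by positivity) (Nat.floor_le (by positivity)) (by linarith)
    have e2 : (L ^ (1 / θ - 1)) ^ (θ / 2) = L ^ ((1 - θ) / 2) := by
      rw [← Real.rpow_mul hL.le]
      congr 1
      field_simp
    rw [e2] at h1
    calc (N : ℝ) ^ (θ / 2) / (θ / 2) ≤ L ^ ((1 - θ) / 2) / (θ / 2) := by gcongr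
      _ = _ := by field_simp
  have hCS : ∀ y, bandMajorant U φ θ L F y ^ 2 ≤
      (∑ j ∈ Finset.Icc 1 N, ENNReal.ofReal ((j : ℝ) ^ (-α))) *
        ∑ j ∈ Finset.Icc 1 N, ENNReal.ofReal ((j : ℝ) ^ α) * D j y ^ 2 := by
    intro y
    have hj0 : ∀ j ∈ Finset.Icc 1 N, (0 : ℝ) < j := fun j hj => by
      exact_mod_cast (Finset.mem_Icc.1 hj).1
    have key : ∀ j ∈ Finset.Icc 1 N,
        ENNReal.ofReal ((j : ℝ) ^ (-α)) * ENNReal.ofReal ((j : ℝ) ^ α) = 1 := fun j hj => by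
      rw [← ENNReal.ofReal_mul (by positivity), ← Real.rpow_add (hj0 j hj)]
      simp
    have h := ENNReal.sum_mul_sq_le (Finset.Icc 1 N) (fun j => ENNReal.ofReal ((j : ℝ) ^ (-α)))
      (fun j => ENNReal.ofReal ((j : ℝ) ^ α) * D j y)
    have e1 : ∑ j ∈ Finset.Icc 1 N, ENNReal.ofReal ((j : ℝ) ^ (-α)) *
        (ENNReal.ofReal ((j : ℝ) ^ α) * D j y) = bandMajorant U φ θ L F y :=
      Finset.sum_congr rfl fun j hj => by rw [← mul_assoc, key j hj, one_mul]
    have e2 : ∑ j ∈ Finset.Icc 1 N, ENNReal.ofReal ((j : ℝ) ^ (-α)) *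
        (ENNReal.ofReal ((j : ℝ) ^ α) * D j y) ^ 2 =
          ∑ j ∈ Finset.Icc 1 N, ENNReal.ofReal ((j : ℝ) ^ α) * D j y ^ 2 :=
      Finset.sum_congr rfl fun j hj => by
        rw [mul_pow, sq (ENNReal.ofReal ((j : ℝ) ^ α)), ← mul_assoc, ← mul_assoc, key j hj, one_mul]
    rwa [e1, e2] at h
  have hpt : ∀ x, ∑ j ∈ Finset.Icc 1 N, ENNReal.ofReal ((j : ℝ) ^ α) * ‖bandPart φ θ L F j x‖ₑ ^ 2 ≤
      (if φ x ^ θ ≤ L then ENNReal.ofReal ((φ x / L) ^ α) else 0) * ‖F x‖ₑ ^ 2 := by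
    intro x
    by_cases hx : φ x ^ θ ≤ L
    · have h1 : ∀ j ∈ Finset.Icc 1 N, ENNReal.ofReal ((j : ℝ) ^ α) * ‖bandPart φ θ L F j x‖ₑ ^ 2 =
          if ⌊φ x / L⌋₊ = j then ENNReal.ofReal ((j : ℝ) ^ α) * ‖F x‖ₑ ^ 2 else 0 := fun j _ => by
        by_cases hj : ⌊φ x / L⌋₊ = j
        · simp [bandPart, hj, hx]
        · simp [bandPart, hj]
      rw [Finset.sum_congr rfl h1, Finset.sum_ite_eq, if_pos hx]
      split_ifs
      · gcongr
        · rw [hα]; linarith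
        · exact Nat.floor_le (div_nonneg (hφ0 x) hL.le)
      · exact zero_le
    · simp [bandPart, hx]
  calc ∫⁻ y, bandMajorant U φ θ L F y ^ 2 ∂ν
      ≤ ∫⁻ y, (ENNReal.ofReal (2 / θ) * ENNReal.ofReal (L ^ ((1 - θ) / 2))) *
          ∑ j ∈ Finset.Icc 1 N, ENNReal.ofReal ((j : ℝ) ^ α) * D j y ^ 2 ∂ν := by
        refine lintegral_mono fun y => (hCS y).trans ?_
        gcongr
    _ = (ENNReal.ofReal (2 / θ) * ENNReal.ofReal (L ^ ((1 - θ) / 2))) *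
          ∑ j ∈ Finset.Icc 1 N, ENNReal.ofReal ((j : ℝ) ^ α) * ∫⁻ y, D j y ^ 2 ∂ν := by
        rw [lintegral_const_mul' _ _ (ENNReal.mul_ne_top ENNReal.ofReal_ne_top ENNReal.ofReal_ne_top),
          lintegral_finsetSum' _ fun j _ => ((hDm j).pow_const 2).const_mul _]
        congr 1
        exact Finset.sum_congr rfl fun j _ => lintegral_const_mul' _ _ ENNReal.ofReal_ne_top
    _ ≤ (ENNReal.ofReal (2 / θ) * ENNReal.ofReal (L ^ ((1 - θ) / 2))) *
          ∑ j ∈ Finset.Icc 1 N, ENNReal.ofReal ((j : ℝ) ^ α) *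
            (expOne ^ 2 * ∫⁻ x, ‖bandPart φ θ L F j x‖ₑ ^ 2 ∂μ) := by
        gcongr with j
        exact hDint j
    _ = (expOne ^ 2 * ENNReal.ofReal (2 / θ)) * (ENNReal.ofReal (L ^ ((1 - θ) / 2)) *
          ∫⁻ x, ∑ j ∈ Finset.Icc 1 N,
            ENNReal.ofReal ((j : ℝ) ^ α) * ‖bandPart φ θ L F j x‖ₑ ^ 2 ∂μ) := by
        rw [lintegral_finsetSum' _ fun j _ =>
          ((memLp_bandPart hφ θ L hF j).1.enorm.pow_const 2).const_mul _]
        simp only [lintegral_const_mul' _ _ ENNReal.ofReal_ne_top, Finset.mul_sum]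
        refine Finset.sum_congr rfl fun j _ => ?_
        ring
    _ ≤ (expOne ^ 2 * ENNReal.ofReal (2 / θ)) * (ENNReal.ofReal (L ^ ((1 - θ) / 2)) *
          ∫⁻ x, (if φ x ^ θ ≤ L then ENNReal.ofReal ((φ x / L) ^ α) else 0) * ‖F x‖ₑ ^ 2 ∂μ) := by
        gcongr with x
        exact hpt x
    _ = _ := by
        rw [← lintegral_const_mul' _ _ ENNReal.ofReal_ne_top]
        congr 1
        refine lintegral_congr fun x => ?_
        rw [← mul_assoc]
        congr 1
        split_ifs
        · rw [← ENNReal.ofReal_mul (by positivity),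
            ← ENNReal.ofReal_mul (Real.rpow_nonneg (hφ0 x) _),
            rpow_half_mul_div_rpow (hφ0 x) hθ hθ1 hL]
        · simp

end Majorants

/-! ### Convergence almost everywhere for isometries of `L²` -/

section Convergence

variable {X Y : Type*} [MeasurableSpace X] [MeasurableSpace Y] {μ : Measure X} {ν : Measure Y}

/-- The dyadic scales `2 ^ (-l m - 1) < t m ≤ 2 ^ (-l m)` of a null sequence. -/
theorem exists_two_pow_bracket {t : ℕ → ℝ} (ht1 : ∀ m, t m ≤ 1) (ht0 : ∀ m, 0 < t m)
    (ht : Tendsto t atTop (𝓝 0)) :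
    ∃ l : ℕ → ℕ, Tendsto l atTop atTop ∧ ∀ m, t m * 2 ^ l m ≤ 1 ∧ 1 < 2 * (t m * 2 ^ l m) := by
  have h : ∀ m, ∃ n : ℕ, (1 / 2 : ℝ) ^ (n + 1) < t m ∧ t m ≤ (1 / 2 : ℝ) ^ n := fun m =>
    exists_nat_pow_near_of_lt_one (ht0 m) (ht1 m) (by norm_num) (by norm_num)
  choose l hl1 hl2 using h
  refine ⟨l, tendsto_atTop.2 fun B => ?_, fun m => ⟨?_, ?_⟩⟩
  · filter_upwards [ht.eventually_lt_const (show (0 : ℝ) < (1 / 2) ^ B by positivity)] with m hm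
    have := (pow_lt_pow_iff_right_of_lt_one₀ (by norm_num) (by norm_num)).1 ((hl1 m).trans hm)
    omega
  · have := hl2 m
    rw [one_div, inv_pow] at this
    rwa [← le_div_iff₀ (by positivity), one_div]
  · have := hl1 m
    rw [one_div, inv_pow, pow_succ, mul_inv, ← div_eq_mul_inv, ← one_div, div_div,
      div_lt_iff₀ (by positivity)] at this
    linarith

/-- The counting bound for weak `l^r`: for a frequency of size `φ`, the number of times `t m`,
with dyadic scale `2 ^ (-l m)`, for which this frequency is high is at most a constant times
`φ ^ (1 - θ)`. -/
theorem tsum_ite_lt_rpow_le {t : ℕ → ℝ} {l : ℕ → ℕ} {θ C φ : ℝ} (hθ : 0 < θ)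
    (hC : ∀ b : ℝ, 0 < b →
      {m : ℕ | b < t m}.Finite ∧ ({m : ℕ | b < t m}.ncard : ℝ) ≤ C * b ^ (-((1 - θ) / θ)))
    (hl : ∀ m, 1 < 2 * (t m * 2 ^ l m)) (hφ : 0 ≤ φ) :
    ∑' m, (if (2 : ℝ) ^ l m < φ ^ θ then (1 : ℝ≥0∞) else 0) ≤
      ENNReal.ofReal (C * 2 ^ ((1 - θ) / θ)) * ENNReal.ofReal (φ ^ (1 - θ)) := by
  rcases hφ.eq_or_lt with h0 | h0
  · have : ∀ m, ¬ (2 : ℝ) ^ l m < φ ^ θ := fun m => by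
      rw [← h0, Real.zero_rpow hθ.ne', not_lt]; positivity
    simp [this]
  have hφθ : 0 < φ ^ θ := Real.rpow_pos_of_pos h0 _
  set b : ℝ := (2 * φ ^ θ)⁻¹ with hb
  have hb0 : 0 < b := by positivity
  obtain ⟨hfin, hcard⟩ := hC b hb0
  have hsub : ∀ m, (2 : ℝ) ^ l m < φ ^ θ → m ∈ hfin.toFinset := fun m hm => by
    rw [Set.Finite.mem_toFinset, Set.mem_ofPred_eq, hb, inv_lt_iff_one_lt_mul₀ (by positivity)]
    have h1 := hl m
    have htm : 0 < t m := by
      by_contra hneg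
      have : t m * 2 ^ l m ≤ 0 := mul_nonpos_of_nonpos_of_nonneg (not_lt.1 hneg) (by positivity)
      linarith
    nlinarith [mul_lt_mul_of_pos_left hm htm]
  have hbr : C * b ^ (-((1 - θ) / θ)) = C * 2 ^ ((1 - θ) / θ) * φ ^ (1 - θ) := by
    rw [hb, Real.inv_rpow (by positivity), Real.rpow_neg (by positivity), inv_inv,
      Real.mul_rpow (by norm_num) hφθ.le, ← Real.rpow_mul hφ, mul_div_cancel₀ _ hθ.ne', mul_assoc]
  calc ∑' m, (if (2 : ℝ) ^ l m < φ ^ θ then (1 : ℝ≥0∞) else 0)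
      ≤ ∑' m, (if m ∈ hfin.toFinset then (1 : ℝ≥0∞) else 0) := by
        refine ENNReal.tsum_le_tsum fun m => ?_
        split_ifs with h1 h2 h2
        · exact le_rfl
        · exact absurd (hsub m h1) h2
        · exact zero_le
        · exact le_rfl
    _ = (hfin.toFinset.card : ℝ≥0∞) := by
        rw [tsum_eq_sum (s := hfin.toFinset) fun m hm => if_neg hm,
          Finset.sum_congr rfl fun m hm => if_pos hm]
        simp
    _ = ENNReal.ofReal ({m : ℕ | b < t m}.ncard : ℝ) := by
        rw [ENNReal.ofReal_natCast, Set.ncard_eq_toFinset_card _ hfin]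
    _ ≤ ENNReal.ofReal (C * b ^ (-((1 - θ) / θ))) := ENNReal.ofReal_le_ofReal hcard
    _ = _ := by rw [hbr, ENNReal.ofReal_mul' (by positivity)]

/-- Low frequencies: the square integral of the majorant at scale `2 ^ l` has the weight
`(φ / 2 ^ l) ^ 2 ≤ (φ / 2 ^ l) ^ (1 - θ)`, which is summable over `l`. -/
theorem ae_tendsto_taylorMajorant_low (U : Lp ℂ 2 μ →ₗᵢ[ℂ] Lp ℂ 2 ν) {φ : X → ℝ}
    (hφ : Measurable φ) (hφ0 : ∀ x, 0 ≤ φ x) {θ : ℝ} (hθ : 0 < θ) (hθ1 : θ < 1) {F : X → ℂ}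
    (hF : MemLp F 2 μ) (hFs : ∫⁻ x, ENNReal.ofReal (φ x ^ (1 - θ)) * ‖F x‖ₑ ^ 2 ∂μ ≠ ∞) :
    ∀ᵐ y ∂ν, Tendsto (fun l : ℕ => taylorMajorant U (fun x => φ x / 2 ^ l)
      (fun x => ((φ x / 2 ^ l : ℝ) : ℂ) * {x | φ x < 2 ^ l}.indicator F x) y) atTop (𝓝 0) := by
  have hψ : ∀ (l : ℕ) x, {x | φ x < 2 ^ l}.indicator F x ≠ 0 → |φ x / 2 ^ l| ≤ 1 := fun l x hx => by
    have h : x ∈ {x | φ x < 2 ^ l} := Set.mem_of_indicator_ne_zero hx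
    rw [abs_of_nonneg (div_nonneg (hφ0 x) (by positivity)), div_le_one (by positivity)]
    exact le_of_lt h
  have hm : ∀ l : ℕ, MemLp (fun x => ((φ x / 2 ^ l : ℝ) : ℂ) * {x | φ x < 2 ^ l}.indicator F x) 2 μ :=
    fun l => by
      simpa using memLp_pow_mul (hφ.div_const _)
        (hF.indicator (measurableSet_lt hφ measurable_const)) (hψ l) 1
  refine ae_tendsto_zero_of_lintegral_sq_le (K := expOne ^ 2)
    (w := fun l x => ENNReal.ofReal ((φ x / 2 ^ l) ^ (1 - θ))) (G := fun x => ‖F x‖ₑ ^ 2)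
    (W := fun x => geomTwo (1 - θ) * ENNReal.ofReal (φ x ^ (1 - θ)))
    (fun l => aemeasurable_taylorMajorant U _ _)
    (fun l => ((hφ.div_const _).pow_const _).ennreal_ofReal) (hF.1.enorm.pow_const 2)
    (ENNReal.pow_ne_top expOne_ne_top) (fun l => ?_)
    (fun x => (tsum_ofReal_div_two_pow_rpow (hφ0 x)).le) ?_
  · refine (lintegral_taylorMajorant_sq_le U (hφ.div_const _) (hm l)
      fun x hx => hψ l x (right_ne_zero_of_mul hx)).trans ?_
    gcongr with x
    by_cases hx : φ x < 2 ^ l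
    · have hs0 : 0 ≤ φ x / 2 ^ l := div_nonneg (hφ0 x) (by positivity)
      have hs1 : φ x / 2 ^ l ≤ 1 := (div_le_one (by positivity)).2 hx.le
      rw [Set.indicator_of_mem (show x ∈ {x | φ x < 2 ^ l} from hx), enorm_mul, mul_pow]
      gcongr
      rw [← ofReal_norm, Complex.norm_real, Real.norm_eq_abs, abs_of_nonneg hs0,
        ← ENNReal.ofReal_pow hs0]
      refine ENNReal.ofReal_le_ofReal ?_
      rw [← Real.rpow_two]
      rcases hs0.eq_or_lt with h | h
      · rw [← h, Real.zero_rpow (by norm_num), Real.zero_rpow (by linarith)]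
      · exact Real.rpow_le_rpow_of_exponent_ge h hs1 (by linarith)
    · simp [hx]
  · simp only [mul_assoc]
    rw [lintegral_const_mul' _ _ (geomTwo_ne_top (by linarith))]
    exact ENNReal.mul_ne_top (geomTwo_ne_top (by linarith)) hFs

/-- The tails of `U F`: on `2 ^ l ≤ φ` the weight `1` is at most `(φ / 2 ^ l) ^ (1 - θ)`, which is
summable over `l`. -/
theorem ae_tendsto_applyL2_tail (U : Lp ℂ 2 μ →ₗᵢ[ℂ] Lp ℂ 2 ν) {φ : X → ℝ}
    (hφ : Measurable φ) (hφ0 : ∀ x, 0 ≤ φ x) {θ : ℝ} (hθ1 : θ < 1) {F : X → ℂ}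
    (hF : MemLp F 2 μ) (hFs : ∫⁻ x, ENNReal.ofReal (φ x ^ (1 - θ)) * ‖F x‖ₑ ^ 2 ∂μ ≠ ∞) :
    ∀ᵐ y ∂ν, Tendsto (fun l : ℕ => ‖applyL2 U ({x | 2 ^ l ≤ φ x}.indicator F) y‖ₑ)
      atTop (𝓝 0) := by
  refine ae_tendsto_zero_of_lintegral_sq_le (K := 1)
    (w := fun l x => ENNReal.ofReal ((φ x / 2 ^ l) ^ (1 - θ))) (G := fun x => ‖F x‖ₑ ^ 2)
    (W := fun x => geomTwo (1 - θ) * ENNReal.ofReal (φ x ^ (1 - θ)))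
    (fun l => (aestronglyMeasurable_applyL2 U _).enorm)
    (fun l => ((hφ.div_const _).pow_const _).ennreal_ofReal) (hF.1.enorm.pow_const 2)
    ENNReal.one_ne_top (fun l => ?_)
    (fun x => (tsum_ofReal_div_two_pow_rpow (hφ0 x)).le) ?_
  · rw [one_mul, lintegral_enorm_sq_applyL2 U
      (hF.indicator (measurableSet_le measurable_const hφ))]
    gcongr with x
    by_cases hx : 2 ^ l ≤ φ x
    · rw [Set.indicator_of_mem (show x ∈ {x | 2 ^ l ≤ φ x} from hx)]
      refine le_mul_of_one_le_left zero_le ?_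
      rw [ENNReal.one_le_ofReal]
      exact Real.one_le_rpow ((one_le_div (by positivity)).2 hx) (by linarith)
    · simp [hx]
  · simp only [mul_assoc]
    rw [lintegral_const_mul' _ _ (geomTwo_ne_top (by linarith))]
    exact ENNReal.mul_ne_top (geomTwo_ne_top (by linarith)) hFs

theorem ae_tendsto_bandMajorant (U : Lp ℂ 2 μ →ₗᵢ[ℂ] Lp ℂ 2 ν) {φ : X → ℝ}
    (hφ : Measurable φ) (hφ0 : ∀ x, 0 ≤ φ x) {θ : ℝ} (hθ : 0 < θ) (hθ1 : θ < 1) {F : X → ℂ}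
    (hF : MemLp F 2 μ) (hFs : ∫⁻ x, ENNReal.ofReal (φ x ^ (1 - θ)) * ‖F x‖ₑ ^ 2 ∂μ ≠ ∞) :
    ∀ᵐ y ∂ν, Tendsto (fun l : ℕ => bandMajorant U φ θ (2 ^ l) F y) atTop (𝓝 0) := by
  have hgeom : geomTwo (1 / 2) ≠ ∞ := geomTwo_ne_top (by norm_num)
  refine ae_tendsto_zero_of_lintegral_sq_le (K := expOne ^ 2 * ENNReal.ofReal (2 / θ))
    (w := fun l x => ENNReal.ofReal (φ x ^ (1 - θ)) *
        (if φ x ^ θ ≤ 2 ^ l then ENNReal.ofReal ((φ x ^ θ / 2 ^ l) ^ (1 / 2 : ℝ)) else 0))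
    (G := fun x => ‖F x‖ₑ ^ 2)
    (W := fun x => geomTwo (1 / 2) * ENNReal.ofReal (φ x ^ (1 - θ)))
    (fun l => Finset.aemeasurable_fun_sum _ fun j _ => aemeasurable_taylorMajorant U _ _)
    (fun l => ?_) (hF.1.enorm.pow_const 2)
    (ENNReal.mul_ne_top (ENNReal.pow_ne_top expOne_ne_top) ENNReal.ofReal_ne_top)
    (fun l => lintegral_bandMajorant_sq_le U hφ hφ0 hθ hθ1 (by positivity) hF) (fun x => ?_) ?_
  · exact (hφ.pow_const _).ennreal_ofReal.mul
      (Measurable.ite (measurableSet_le (hφ.pow_const θ) measurable_const)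
        (((hφ.pow_const θ).div_const _).pow_const _).ennreal_ofReal measurable_const)
  · rw [ENNReal.tsum_mul_left, mul_comm]
    gcongr
    exact tsum_ite_ofReal_div_two_pow_rpow_le (Real.rpow_nonneg (hφ0 x) _) (by norm_num)
  · simp only [mul_assoc]
    rw [lintegral_const_mul' _ _ hgeom]
    exact ENNReal.mul_ne_top hgeom hFs

/-- High frequencies: the square integrals are summed over the sequence `t` itself. -/
theorem ae_tendsto_applyL2_high (U : Lp ℂ 2 μ →ₗᵢ[ℂ] Lp ℂ 2 ν) {φ : X → ℝ}
    (hφ : Measurable φ) (hφ0 : ∀ x, 0 ≤ φ x) {θ : ℝ} (hθ : 0 < θ) {F : X → ℂ}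
    (hF : MemLp F 2 μ) (hFs : ∫⁻ x, ENNReal.ofReal (φ x ^ (1 - θ)) * ‖F x‖ₑ ^ 2 ∂μ ≠ ∞)
    {t : ℕ → ℝ} {l : ℕ → ℕ} {C : ℝ} (hC : ∀ b : ℝ, 0 < b →
      {m : ℕ | b < t m}.Finite ∧ ({m : ℕ | b < t m}.ncard : ℝ) ≤ C * b ^ (-((1 - θ) / θ)))
    (hl : ∀ m, 1 < 2 * (t m * 2 ^ l m)) :
    ∀ᵐ y ∂ν, Tendsto (fun m : ℕ => ‖applyL2 U (fun x =>
      Complex.exp (Complex.I * ((t m * φ x : ℝ) : ℂ)) *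
        {x | 2 ^ l m ≤ φ x ∧ 2 ^ l m < φ x ^ θ}.indicator F x) y‖ₑ) atTop (𝓝 0) := by
  refine ae_tendsto_zero_of_lintegral_sq_le (K := 1)
    (w := fun m x => if (2 : ℝ) ^ l m < φ x ^ θ then (1 : ℝ≥0∞) else 0)
    (G := fun x => ‖F x‖ₑ ^ 2)
    (W := fun x => ENNReal.ofReal (C * 2 ^ ((1 - θ) / θ)) * ENNReal.ofReal (φ x ^ (1 - θ)))
    (fun m => (aestronglyMeasurable_applyL2 U _).enorm)
    (fun m => Measurable.ite (measurableSet_lt measurable_const (hφ.pow_const θ))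
      measurable_const measurable_const) (hF.1.enorm.pow_const 2)
    ENNReal.one_ne_top (fun m => ?_) (fun x => tsum_ite_lt_rpow_le hθ hC hl (hφ0 x)) ?_
  · have hm : MemLp ({x | 2 ^ l m ≤ φ x ∧ 2 ^ l m < φ x ^ θ}.indicator F) 2 μ :=
      hF.indicator ((measurableSet_le measurable_const hφ).inter
        (measurableSet_lt measurable_const (hφ.pow_const θ)))
    rw [one_mul, lintegral_enorm_sq_applyL2 U (memLp_exp_I_mul (hφ.const_mul (t m)) hm)]
    gcongr with x
    by_cases hx : 2 ^ l m ≤ φ x ∧ 2 ^ l m < φ x ^ θ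
    · rw [Set.indicator_of_mem
        (show x ∈ {x | 2 ^ l m ≤ φ x ∧ 2 ^ l m < φ x ^ θ} from hx), if_pos hx.2, one_mul,
        enorm_mul, ← ofReal_norm (Complex.exp _), norm_exp_I_mul, ENNReal.ofReal_one, one_mul]
    · rw [Set.indicator_of_notMem
        (show x ∉ {x | 2 ^ l m ≤ φ x ∧ 2 ^ l m < φ x ^ θ} from hx)]
      simp
  · simp only [mul_assoc]
    rw [lintegral_const_mul' _ _ ENNReal.ofReal_ne_top]
    exact ENNReal.mul_ne_top ENNReal.ofReal_ne_top hFs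

/-- Domination of the frequencies with `L ≤ φ` and `φ ^ θ ≤ L`, uniformly in `0 ≤ t ≤ 1 / L`. On
the band `⌊φ / L⌋ = j` the phase `t φ` differs from the constant `t L j` by at most `1`. -/
theorem enorm_applyL2_mid_le (U : Lp ℂ 2 μ →ₗᵢ[ℂ] Lp ℂ 2 ν) {φ : X → ℝ}
    (hφ : Measurable φ) (hφ0 : ∀ x, 0 ≤ φ x) {θ : ℝ} (hθ : 0 < θ) {F : X → ℂ}
    (hF : MemLp F 2 μ) {t L : ℝ} (ht : 0 ≤ t) (hL : 0 < L) (htL : t * L ≤ 1) :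
    ∀ᵐ y ∂ν, ‖applyL2 U (fun x => Complex.exp (Complex.I * ((t * φ x : ℝ) : ℂ)) *
        {x | L ≤ φ x ∧ φ x ^ θ ≤ L}.indicator F x) y‖ₑ ≤ bandMajorant U φ θ L F y := by
  have hsum : ∀ x, ∑ j ∈ Finset.Icc 1 ⌊L ^ (1 / θ - 1)⌋₊,
      Complex.exp (Complex.I * ((t * φ x : ℝ) : ℂ)) * bandPart φ θ L F j x =
      Complex.exp (Complex.I * ((t * φ x : ℝ) : ℂ)) *
        {x | L ≤ φ x ∧ φ x ^ θ ≤ L}.indicator F x := by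
    intro x
    rw [← Finset.mul_sum]
    congr 1
    by_cases hx : φ x ^ θ ≤ L
    · have h1 : ∀ j ∈ Finset.Icc 1 ⌊L ^ (1 / θ - 1)⌋₊,
          bandPart φ θ L F j x = if ⌊φ x / L⌋₊ = j then F x else 0 := fun j _ => by
        simp [bandPart, Set.indicator_apply, hx]
      rw [Finset.sum_congr rfl h1, Finset.sum_ite_eq, Set.indicator_apply]
      refine if_congr ?_ rfl rfl
      rw [Finset.mem_Icc, Nat.one_le_floor_iff, one_le_div hL]
      refine and_congr_right fun _ => ⟨fun _ => hx, fun _ => Nat.floor_le_floor ?_⟩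
      have h2 : φ x ≤ L ^ (1 / θ) := by
        have := Real.rpow_le_rpow (Real.rpow_nonneg (hφ0 x) θ) hx (by positivity : 0 ≤ 1 / θ)
        rwa [← Real.rpow_mul (hφ0 x), mul_one_div_cancel hθ.ne', Real.rpow_one] at this
      rw [Real.rpow_sub_one hL.ne']
      gcongr
    · simp [bandPart, hx]
  have hterm : ∀ᵐ y ∂ν, ∀ j : ℕ, ‖applyL2 U (fun x =>
      Complex.exp (Complex.I * ((t * φ x : ℝ) : ℂ)) * bandPart φ θ L F j x) y‖ₑ ≤
        taylorMajorant U (fun x => φ x / L - j) (bandPart φ θ L F j) y :=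
    ae_all_iff.2 fun j => enorm_applyL2_exp_le U (φ := fun x => t * φ x)
      (κ := t * L * j) (τ := t * L) ((hφ.div_const L).sub_const _) (memLp_bandPart hφ θ L hF j)
      (abs_div_sub_le_of_bandPart_ne_zero hφ0 hL) (by positivity) htL
      (fun x => by field_simp; ring)
  filter_upwards [enorm_applyL2_le_sum _ U (fun j => memLp_exp_I_mul (hφ.const_mul t)
    (memLp_bandPart hφ θ L hF j)) hsum, hterm] with y h1 h2
  exact h1.trans (Finset.sum_le_sum fun j _ => h2 j)

/-- Splitting of `U (exp (i t φ) F) - U F` into low, intermediate and high frequencies. -/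
theorem enorm_applyL2_exp_sub_le (U : Lp ℂ 2 μ →ₗᵢ[ℂ] Lp ℂ 2 ν) {φ : X → ℝ}
    (hφ : Measurable φ) (hφ0 : ∀ x, 0 ≤ φ x) {θ : ℝ} (hθ : 0 < θ) {F : X → ℂ}
    (hF : MemLp F 2 μ) {t L : ℝ} (ht : 0 ≤ t) (hL : 0 < L) (htL : t * L ≤ 1) :
    ∀ᵐ y ∂ν,
      ‖applyL2 U (fun x => Complex.exp (Complex.I * ((t * φ x : ℝ) : ℂ)) * F x) y -
        applyL2 U F y‖ₑ ≤
      taylorMajorant U (fun x => φ x / L)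
        (fun x => ((φ x / L : ℝ) : ℂ) * {x | φ x < L}.indicator F x) y +
      bandMajorant U φ θ L F y +
      ‖applyL2 U (fun x => Complex.exp (Complex.I * ((t * φ x : ℝ) : ℂ)) *
        {x | L ≤ φ x ∧ L < φ x ^ θ}.indicator F x) y‖ₑ +
      ‖applyL2 U ({x | L ≤ φ x}.indicator F) y‖ₑ := by
  have hlow : MemLp ({x | φ x < L}.indicator F) 2 μ :=
    hF.indicator (measurableSet_lt hφ measurable_const)
  have htail : MemLp ({x | L ≤ φ x}.indicator F) 2 μ :=
    hF.indicator (measurableSet_le measurable_const hφ)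
  have hmid := memLp_exp_I_mul (hφ.const_mul t) (hF.indicator
    ((measurableSet_le measurable_const hφ).inter
      (measurableSet_le (hφ.pow_const θ) measurable_const)) : MemLp
        ({x | L ≤ φ x ∧ φ x ^ θ ≤ L}.indicator F) 2 μ)
  have hhigh := memLp_exp_I_mul (hφ.const_mul t) (hF.indicator
    ((measurableSet_le measurable_const hφ).inter
      (measurableSet_lt measurable_const (hφ.pow_const θ))) : MemLp
        ({x | L ≤ φ x ∧ L < φ x ^ θ}.indicator F) 2 μ)
  have hdiff : MemLp (fun x => (Complex.exp (Complex.I * ((t * φ x : ℝ) : ℂ)) - 1) *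
      {x | φ x < L}.indicator F x) 2 μ := by
    refine ((memLp_exp_I_mul (hφ.const_mul t) hlow).sub hlow).ae_eq
      (Eventually.of_forall fun x => ?_)
    simp only [Pi.sub_apply]
    ring
  have eF : F = fun x => {x | φ x < L}.indicator F x + {x | L ≤ φ x}.indicator F x := by
    funext x
    rcases lt_or_ge (φ x) L with h | h
    · simp [h, not_le.2 h]
    · simp [h, not_lt.2 h]
  -- `exp (i t φ) F` minus the three main parts is the low part of `F`, which cancels with that of
  -- `U F` and leaves the tail.
  have eE : (fun x => Complex.exp (Complex.I * ((t * φ x : ℝ) : ℂ)) * F x) = fun x =>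
      ((Complex.exp (Complex.I * ((t * φ x : ℝ) : ℂ)) - 1) * {x | φ x < L}.indicator F x +
        Complex.exp (Complex.I * ((t * φ x : ℝ) : ℂ)) *
          {x | L ≤ φ x ∧ φ x ^ θ ≤ L}.indicator F x) +
      (Complex.exp (Complex.I * ((t * φ x : ℝ) : ℂ)) *
          {x | L ≤ φ x ∧ L < φ x ^ θ}.indicator F x + {x | φ x < L}.indicator F x) := by
    funext x
    rcases lt_or_ge (φ x) L with h | h
    · simp [h, not_le.2 h]
      ring
    · rcases le_or_gt (φ x ^ θ) L with h' | h'
      · simp [h, h', not_lt.2 h, not_lt.2 h']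
      · simp [h, h', not_lt.2 h, not_le.2 h']
  have a1 := applyL2_add U hlow htail
  rw [← eF] at a1
  have a2 := applyL2_add U (hdiff.add hmid) (hhigh.add hlow)
  simp only [Pi.add_def] at a2
  rw [← eE] at a2
  have a3 := applyL2_add U hdiff hmid
  have a4 := applyL2_add U hhigh hlow
  have b1 := enorm_applyL2_exp_sub_one_le U (φ := fun x => t * φ x) (τ := t * L)
    (ψ := fun x => φ x / L) (hφ.div_const L) hlow
    (fun x hx => by
      have h : x ∈ {x | φ x < L} := Set.mem_of_indicator_ne_zero hx
      rw [abs_of_nonneg (div_nonneg (hφ0 x) hL.le), div_le_one hL]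
      exact le_of_lt h) (by positivity) htL (fun x => by field_simp)
  filter_upwards [a1, a2, a3, a4, b1, enorm_applyL2_mid_le U hφ hφ0 hθ hF ht hL htL]
    with y a1 a2 a3 a4 b1 b2
  rw [a2, a1, a3, a4]
  refine le_trans ?_ (add_le_add_left (add_le_add_left (add_le_add b1 b2) _) _)
  generalize applyL2 U ({x | φ x < L}.indicator F) y = z
  generalize applyL2 U ({x | L ≤ φ x}.indicator F) y = z'
  refine le_trans (le_of_eq ?_) ((enorm_sub_le).trans (add_le_add_left
    ((enorm_add_le _ _).trans (add_le_add_left (enorm_add_le _ _) _)) _))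
  congr 1
  ring

/-- Almost everywhere convergence of `U (exp (i t m φ) F)` to `U F` for an isometry `U` of `L²`
spaces, along a null sequence in weak `l^r` with `r = (1 - θ) / θ`, if `φ ^ (1 - θ) |F|²` is
integrable. -/
theorem ae_tendsto_applyL2_exp (U : Lp ℂ 2 μ →ₗᵢ[ℂ] Lp ℂ 2 ν) {φ : X → ℝ}
    (hφ : Measurable φ) (hφ0 : ∀ x, 0 ≤ φ x) {θ : ℝ} (hθ : 0 < θ) (hθ1 : θ < 1) {F : X → ℂ}
    (hF : MemLp F 2 μ) (hFs : ∫⁻ x, ENNReal.ofReal (φ x ^ (1 - θ)) * ‖F x‖ₑ ^ 2 ∂μ ≠ ∞)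
    {t : ℕ → ℝ} (ht1 : ∀ m, t m ≤ 1) (ht0 : ∀ m, 0 < t m) (ht : Tendsto t atTop (𝓝 0))
    (hweak : MemWeakLr ((1 - θ) / θ) t) :
    ∀ᵐ y ∂ν, Tendsto
      (fun m => applyL2 U (fun x => Complex.exp (Complex.I * ((t m * φ x : ℝ) : ℂ)) * F x) y)
      atTop (𝓝 (applyL2 U F y)) := by
  obtain ⟨C, -, hC⟩ := hweak
  obtain ⟨l, hlim, hl⟩ := exists_two_pow_bracket ht1 ht0 ht
  have hle := ae_all_iff.2 fun m => enorm_applyL2_exp_sub_le U hφ hφ0 hθ hF (ht0 m).le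
    (L := 2 ^ l m) (by positivity) (hl m).1
  filter_upwards [hle, ae_tendsto_taylorMajorant_low U hφ hφ0 hθ hθ1 hF hFs,
    ae_tendsto_bandMajorant U hφ hφ0 hθ hθ1 hF hFs,
    ae_tendsto_applyL2_high U hφ hφ0 hθ hF hFs hC fun m => (hl m).2,
    ae_tendsto_applyL2_tail U hφ hφ0 hθ1 hF hFs] with y h h1 h2 h3 h4
  rw [tendsto_iff_edist_tendsto_0]
  simp only [edist_eq_enorm_sub]
  have hz := (((h1.comp hlim).add (h2.comp hlim)).add h3).add (h4.comp hlim)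
  simp only [add_zero] at hz
  exact tendsto_of_tendsto_of_tendsto_of_le_of_le tendsto_const_nhds hz (fun m => zero_le) h

end Convergence

/-! ### Sobolev functions and Schrödinger means on the frequency side -/

section Sobolev

/-- A distribution in the Sobolev space of order `s ≥ 0` is given by the inverse Fourier transform
of an `L²` function `G` for which `(1 + |η|²) ^ s |G|²` is integrable. -/
theorem exists_fourier_of_memSobolev {n : ℕ} {s : ℝ} (hs : 0 ≤ s) {f : 𝓢'(Rn n, ℂ)}
    (hf : TemperedDistribution.MemSobolev s 2 f) :
    ∃ g : Lp ℂ 2 (volume : Measure (Rn n)), f = Lp.toTemperedDistribution g ∧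
      ∫⁻ η : Rn n, ENNReal.ofReal ((1 + ‖η‖ ^ 2) ^ s) *
        ‖(𝓕 g : Lp ℂ 2 (volume : Measure (Rn n))) η‖ₑ ^ 2 ≠ ∞ := by
  obtain ⟨u, hu⟩ := TemperedDistribution.memSobolev_iff_exists_smulLeftCLM_fourier.1 hf
  have hmeas : Measurable fun η : Rn n => (((1 + ‖η‖ ^ 2) ^ (-s / 2) : ℝ) : ℂ) := by fun_prop
  have hw : MemLp (fun η : Rn n => (((1 + ‖η‖ ^ 2) ^ (-s / 2) : ℝ) : ℂ)) ∞ volume := by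
    refine memLp_top_of_bound (C := 1) hmeas.aestronglyMeasurable (Eventually.of_forall fun η => ?_)
    rw [Complex.norm_real, Real.norm_eq_abs, abs_of_nonneg (by positivity)]
    exact Real.rpow_le_one_of_one_le_of_nonpos (by simp) (by linarith)
  set G : Lp ℂ 2 (volume : Measure (Rn n)) := hw.toLp _ • u with hG
  have hGf : 𝓕 f = Lp.toTemperedDistribution G := by
    rw [hG, Lp.toTemperedDistribution_smul_eq (by fun_prop), ← hu,
      TemperedDistribution.smulLeftCLM_smulLeftCLM_apply (by fun_prop) (by fun_prop)]
    convert! (TemperedDistribution.smulLeftCLM_const 1 (𝓕 f)).symm using 1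
    · simp
    · congr
      ext x
      rw [Pi.mul_apply]
      norm_cast
      rw [← Real.rpow_add (by positivity)]
      ring_nf
      simp
  refine ⟨𝓕⁻ G, ?_, ?_⟩
  · rw [← Lp.fourierInv_toTemperedDistribution_eq, ← hGf]
    simp
  · have e : (𝓕 (𝓕⁻ G : Lp ℂ 2 (volume : Measure (Rn n))) : Lp ℂ 2 (volume : Measure (Rn n))) = G :=
      FourierTransform.fourier_fourierInv_eq G
    rw [e]
    have h : ∫⁻ η : Rn n, ENNReal.ofReal ((1 + ‖η‖ ^ 2) ^ s) * ‖G η‖ₑ ^ 2 = ‖u‖ₑ ^ 2 := by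
      rw [← lintegral_enorm_sq_eq_enorm_sq]
      refine lintegral_congr_ae ?_
      filter_upwards [Lp.coeFn_lpSMul (r := 2) (hw.toLp _) u, hw.coeFn_toLp] with η h1 h2
      rw [hG, h1, Pi.smul_apply', h2, smul_eq_mul, enorm_mul, mul_pow, ← mul_assoc,
        ← ofReal_norm (Complex.ofReal _), Complex.norm_real, Real.norm_eq_abs,
        abs_of_nonneg (by positivity), ← ENNReal.ofReal_pow (by positivity),
        ← ENNReal.ofReal_mul (by positivity), ← Real.rpow_mul_natCast (by positivity),
        ← Real.rpow_add (by positivity)]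
      have : s + -s / 2 * (2 : ℕ) = 0 := by push_cast; ring
      rw [this]
      simp
    rw [h]
    exact ENNReal.pow_ne_top enorm_ne_top

theorem schrodingerMean_eq_applyL2 {n : ℕ} (a t : ℝ) (g : Lp ℂ 2 (volume : Measure (Rn n))) :
    ⇑(schrodingerMean a t g) =
      applyL2 (Lp.fourierTransformₗᵢ (Rn n) ℂ).symm.toLinearIsometry
        (fun η => Complex.exp (Complex.I * ((t * ‖(2 * Real.pi) • η‖ ^ a : ℝ) : ℂ)) *
          (𝓕 g : Lp ℂ 2 (volume : Measure (Rn n))) η) := by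
  have hm := memLp_exp_I_mul (φ := fun η : Rn n => t * ‖(2 * Real.pi) • η‖ ^ a) (by fun_prop)
    (Lp.memLp (𝓕 g : Lp ℂ 2 (volume : Measure (Rn n))))
  rw [applyL2_of_memLp _ hm]
  have e : ((memLp_schrodingerMultiplier a t).toLp (schrodingerMultiplier (n := n) a t) •
      (𝓕 g : Lp ℂ 2 (volume : Measure (Rn n))) : Lp ℂ 2 (volume : Measure (Rn n))) =
        hm.toLp _ := by
    refine Lp.ext ?_
    filter_upwards [Lp.coeFn_lpSMul (r := 2) ((memLp_schrodingerMultiplier a t).toLp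
      (schrodingerMultiplier (n := n) a t)) (𝓕 g : Lp ℂ 2 (volume : Measure (Rn n))),
      (memLp_schrodingerMultiplier (n := n) a t).coeFn_toLp, hm.coeFn_toLp] with η h1 h2 h3
    rw [h1, h3, Pi.smul_apply', h2]
    rfl
  rw [schrodingerMean, e]
  rfl

theorem applyL2_fourier {n : ℕ} (g : Lp ℂ 2 (volume : Measure (Rn n))) :
    applyL2 (Lp.fourierTransformₗᵢ (Rn n) ℂ).symm.toLinearIsometry
      (𝓕 g : Lp ℂ 2 (volume : Measure (Rn n))) = g := by
  rw [applyL2_of_memLp _ (Lp.memLp _), Lp.toLp_coeFn]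
  have h : (Lp.fourierTransformₗᵢ (Rn n) ℂ).symm.toLinearIsometry (𝓕 g) = g :=
    (Lp.fourierTransformₗᵢ (Rn n) ℂ).symm_apply_apply g
  rw [h]

end Sobolev

theorem theorem4 (n : ℕ) (hn : 2 ≤ n) (a s : ℝ) (ha : 0 < a) (ha1 : a ≠ 1)
    (hs : 0 < s) (hsa : s < a / 2)
    (t : ℕ → ℝ) (ht1 : t 0 < 1) (ht_anti : StrictAnti t) (ht_pos : ∀ m, 0 < t m)
    (ht_lim : Tendsto t atTop (𝓝 0))
    (ht_weak : MemWeakLr (2 * s / (a - 2 * s)) t)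
    (f : 𝓢'(Rn n, ℂ)) (hf : TemperedDistribution.MemSobolev s 2 f) :
    ∃ g : Lp ℂ 2 (volume : Measure (Rn n)),
      f = Lp.toTemperedDistribution g ∧
      ∀ᵐ x : Rn n, Tendsto (fun m => schrodingerMean a (t m) g x) atTop (𝓝 (g x)) := by
  obtain ⟨g, hfg, hg⟩ := exists_fourier_of_memSobolev hs.le hf
  refine ⟨g, hfg, ?_⟩
  -- With `φ η = |2πη| ^ a` and `θ = (a - 2 s) / a` one has `φ ^ (1 - θ) = |2πη| ^ (2 s)`, and the
  -- exponent of the weak space is `(1 - θ) / θ`.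
  have hθ : 0 < (a - 2 * s) / a := div_pos (by linarith) ha
  have hθ1 : (a - 2 * s) / a < 1 := (div_lt_one ha).2 (by linarith)
  have h1θ : 1 - (a - 2 * s) / a = 2 * s / a := by field_simp; ring
  have hr : (1 - (a - 2 * s) / a) / ((a - 2 * s) / a) = 2 * s / (a - 2 * s) := by
    rw [h1θ, div_div_div_cancel_right₀ ha.ne']
  have hFs : ∫⁻ η : Rn n, ENNReal.ofReal ((‖(2 * Real.pi) • η‖ ^ a) ^ (1 - (a - 2 * s) / a)) *
      ‖(𝓕 g : Lp ℂ 2 (volume : Measure (Rn n))) η‖ₑ ^ 2 ≠ ∞ := by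
    refine ne_top_of_le_ne_top
      (ENNReal.mul_ne_top (ENNReal.ofReal_ne_top (r := (2 * Real.pi) ^ (2 * s))) hg) ?_
    rw [← lintegral_const_mul' _ _ ENNReal.ofReal_ne_top]
    refine lintegral_mono fun η => ?_
    rw [← mul_assoc, ← ENNReal.ofReal_mul (by positivity)]
    gcongr
    rw [h1θ, ← Real.rpow_mul (norm_nonneg _), mul_div_cancel₀ _ ha.ne', norm_smul,
      Real.norm_eq_abs, abs_of_nonneg (by positivity), Real.mul_rpow (by positivity) (norm_nonneg _)]
    gcongr
    rw [Real.rpow_mul (norm_nonneg _), Real.rpow_two]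
    gcongr
    linarith
  have key := ae_tendsto_applyL2_exp (Lp.fourierTransformₗᵢ (Rn n) ℂ).symm.toLinearIsometry
    (φ := fun η : Rn n => ‖(2 * Real.pi) • η‖ ^ a) (by fun_prop) (fun η => by positivity) hθ hθ1
    (Lp.memLp (𝓕 g : Lp ℂ 2 (volume : Measure (Rn n)))) hFs
    (fun m => (ht_anti.antitone (Nat.zero_le m)).trans ht1.le) ht_pos ht_lim (by rwa [hr])
  rw [applyL2_fourier] at key
  simpa only [schrodingerMean_eq_applyL2] using key
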